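/- Let $q=3^r$ with $r\ge 1$, let $\mathrm{tr}:\mathbb F_q\to\mathbb F_3$ be the trace map, and write $\mathrm{Tr}$ for the trace of a matrix and ${}^tM$ for the transpose of $M$. For $n\ge1$ let $Q=Q(2n+1,q)$ be the group of the $(2n+1)\times(2n+1)$ matrices over $\mathbb F_q$ $$\begin{bmatrix}A&0&0\\0&{}^tA^{-1}&0\\0&0&1\end{bmatrix}\begin{bmatrix}1_n&B&-{}^th\\0&1_n&0\\0&h&1\end{bmatrix},\qquad A\in GL(n,q),\ B\in\mathbb F_q^{n\times n},\ h\in\mathbb F_q^{1\times n},\ B+{}^tB+{}^thh=0.$$ Let $\rho=\mathrm{diag}(1_n,1_n,-1)$ and, for $0\le k\le n$, let $$\sigma_k=\begin{bmatrix}0&0&1_k&0&0\\0&1_{n-k}&0&0&0\\1_k&0&0&0&0\\0&0&0&1_{n-k}&0\\0&0&0&0&1\end{bmatrix}.$$ Put $DC_1^-(n,q)=Q\sigma_{n-1}Q$ and $DC_2^-(n,q)=\rho Q\sigma_{n-1}Q$ for odd $n\ge1$, and $DC_1^+(n,q)=Q\sigma_{n-2}Q$ and $DC_2^+(n,q)=\rho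 Q\sigma_{n-2}Q$ for even $n\ge2$. Let $D$ be one of these sets, $N=|D|$, and let $g_1,\dots,g_N$ be any ordering of the elements of $D$. Define the ternary linear code $$C(D)=\{u\in\mathbb F_3^N : u_1\mathrm{Tr}\,g_1+\dots+u_N\mathrm{Tr}\,g_N=0\ \text{in }\mathbb F_q\},$$ and its dual $C(D)^\perp=\{w\in\mathbb F_3^N : w\cdot u=0\text{ for all }u\in C(D)\}$. For $a\in\mathbb F_q$ put $c(a)=(\mathrm{tr}(a\,\mathrm{Tr}\,g_1),\dots,\mathrm{tr}(a\,\mathrm{Tr}\,g_N))$. Theorem 4.2. (1) For every odd $n\ge1$, every $q=3^r$ and $D=DC_i^-(n,q)$, $i=1,2$, the map $a\mapsto c(a)$ is an $\mathbb F_3$-linear isomorphism from $\mathbb F_q$ onto $C(D)^\perp$. (2) The same holds for every even $n\ge2$, every $q=3^r$ and $D=DC_i^+(n,q)$, $i=1,2$. Hence in all these cases the dual code $C(D)^\perp$ has dimension $r$ over $\mathbb F_3$. -/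

import Mathlib

open scoped Pointwise Matrix

noncomputable section

/-- Index type of the rows and columns of the matrices in `O(2n+1,q)`, in blocks of sizes
`n`, `n`, `1`. -/
abbrev OIndex (n : ℕ) : Type := (Fin n ⊕ Fin n) ⊕ Fin 1

/-- The block matrix `diag(A, ᵗA⁻¹, 1)`. -/
def leviMatrix {F : Type*} [Field F] {n : ℕ} (A : GL (Fin n) F) :
    Matrix (OIndex n) (OIndex n) F :=
  Matrix.fromBlocks
    (Matrix.fromBlocks (A : Matrix (Fin n) (Fin n) F) 0
      0 ((A⁻¹ : GL (Fin n) F) : Matrix (Fin n) (Fin n) F)ᵀ)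
    0
    0
    1

/-- The block matrix with rows `(1, B, -ᵗh)`, `(0, 1, 0)`, `(0, h, 1)`. -/
def unipotentMatrix {F : Type*} [Field F] {n : ℕ}
    (B : Matrix (Fin n) (Fin n) F) (h : Matrix (Fin 1) (Fin n) F) :
    Matrix (OIndex n) (OIndex n) F :=
  Matrix.fromBlocks
    (Matrix.fromBlocks 1 B
      0 1)
    (Matrix.fromRows (-hᵀ) 0)
    (Matrix.fromCols 0 h)
    1

/-- The subgroup `Q(2n+1,q)` (as a set of matrices): all products
`diag(A, ᵗA⁻¹, 1) * unipotentMatrix B h` with `A ∈ GL(n,q)` and `B + ᵗB + ᵗh h = 0`. -/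
def QSet (F : Type*) [Field F] (n : ℕ) : Set (Matrix (OIndex n) (OIndex n) F) :=
  {w | ∃ (A : GL (Fin n) F) (B : Matrix (Fin n) (Fin n) F) (h : Matrix (Fin 1) (Fin n) F),
    B + Bᵀ + hᵀ * h = 0 ∧ w = leviMatrix A * unipotentMatrix B h}

/-- The matrix `ρ = diag(1_n, 1_n, -1)`. -/
def rhoMatrix (F : Type*) [Field F] (n : ℕ) : Matrix (OIndex n) (OIndex n) F :=
  Matrix.fromBlocks 1 0 0 (-1)

/-- The matrix `σ_k`: it exchanges the `i`-th basis vectors of the first two blocks for the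
first `k` indices `i`, and fixes all the other basis vectors. -/
def sigmaMatrix (F : Type*) [Field F] (n k : ℕ) : Matrix (OIndex n) (OIndex n) F :=
  Matrix.fromBlocks
    (Matrix.fromBlocks
      (Matrix.diagonal fun i : Fin n => if (i : ℕ) < k then 0 else 1)
      (Matrix.diagonal fun i : Fin n => if (i : ℕ) < k then 1 else 0)
      (Matrix.diagonal fun i : Fin n => if (i : ℕ) < k then 1 else 0)
      (Matrix.diagonal fun i : Fin n => if (i : ℕ) < k then 0 else 1))
    0
    0
    1

/-- `DC₁⁻(n,q) = Q σ_{n-1} Q` (used for odd `n`). -/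
def DCOneMinus (F : Type*) [Field F] (n : ℕ) : Set (Matrix (OIndex n) (OIndex n) F) :=
  QSet F n * {sigmaMatrix F n (n - 1)} * QSet F n

/-- `DC₂⁻(n,q) = ρ Q σ_{n-1} Q` (used for odd `n`). -/
def DCTwoMinus (F : Type*) [Field F] (n : ℕ) : Set (Matrix (OIndex n) (OIndex n) F) :=
  {rhoMatrix F n} * QSet F n * {sigmaMatrix F n (n - 1)} * QSet F n

/-- `DC₁⁺(n,q) = Q σ_{n-2} Q` (used for even `n ≥ 2`). -/
def DCOnePlus (F : Type*) [Field F] (n : ℕ) : Set (Matrix (OIndex n) (OIndex n) F) :=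
  QSet F n * {sigmaMatrix F n (n - 2)} * QSet F n

/-- `DC₂⁺(n,q) = ρ Q σ_{n-2} Q` (used for even `n ≥ 2`). -/
def DCTwoPlus (F : Type*) [Field F] (n : ℕ) : Set (Matrix (OIndex n) (OIndex n) F) :=
  {rhoMatrix F n} * QSet F n * {sigmaMatrix F n (n - 2)} * QSet F n

/-- The vector `v = (Tr g₁, …, Tr g_N)` of matrix traces attached to an ordering
`g₁, …, g_N` of a set `D` of matrices. -/
def traceVector {F : Type*} [Field F] {n N : ℕ} {D : Set (Matrix (OIndex n) (OIndex n) F)}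
    (g : Fin N ≃ D) : Fin N → F :=
  fun j => Matrix.trace (g j : Matrix (OIndex n) (OIndex n) F)

/-- The ternary code `{u ∈ 𝔽₃^N | u · v = 0}` attached to `v ∈ 𝔽_q^N`. -/
def ternaryCode {F : Type*} [Field F] [Algebra (ZMod 3) F] {N : ℕ} (v : Fin N → F) :
    Submodule (ZMod 3) (Fin N → ZMod 3) where
  carrier := {u | (fun j => algebraMap (ZMod 3) F (u j)) ⬝ᵥ v = 0}
  zero_mem' := by simp [dotProduct]
  add_mem' := by
    intro a b ha hb
    simp only [Set.mem_ofPred_eq, dotProduct, Pi.add_apply, map_add, add_mul,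
      Finset.sum_add_distrib] at *
    rw [ha, hb, add_zero]
  smul_mem' := by
    intro c a ha
    simp only [Set.mem_ofPred_eq, dotProduct, Pi.smul_apply, smul_eq_mul, map_mul, mul_assoc,
      ← Finset.mul_sum] at *
    rw [ha, mul_zero]

/-- The dual `C^⊥ = {w ∈ 𝔽₃^N | w · u = 0 for all u ∈ C}` of a ternary code `C`. -/
def dualCode {N : ℕ} (C : Submodule (ZMod 3) (Fin N → ZMod 3)) :
    Submodule (ZMod 3) (Fin N → ZMod 3) where
  carrier := {w | ∀ u ∈ C, w ⬝ᵥ u = 0}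
  zero_mem' := by intro u _; simp
  add_mem' := by
    intro a b ha hb u hu
    rw [add_dotProduct, ha u hu, hb u hu, add_zero]
  smul_mem' := by
    intro c a ha u hu
    rw [smul_dotProduct, ha u hu, smul_zero]

/-- The word `c(a) = (tr(a v₁), …, tr(a v_N))`, with `tr` the trace of `𝔽_q` over `𝔽₃`. -/
def traceWord {F : Type*} [Field F] [Algebra (ZMod 3) F] {N : ℕ} (v : Fin N → F) (a : F) :
    Fin N → ZMod 3 :=
  fun j => Algebra.trace (ZMod 3) F (a * v j)

end

/-! By Delsarte duality the words `c(a)` always fill the dual code, so only injectivity of `c`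
depends on `D`: no nonzero `a` may satisfy `tr(a Tr g) = 0` for every `g ∈ D`. If the matrix traces
exhaust `F`, this is nondegeneracy of the trace form. For `k ≥ 2`, suitable elements `σ_k u`, with
`u` unipotent in `Q`, have trace `x² + y²` plus a constant, and every element of a finite field is a
sum of two squares. For `k = 0`, `σ_0 = 1` and the Levi elements lie in `D`, with traces `Tr A + Tr
A⁻¹ + 1`; multiplying by `ρ` only turns the `1` into `-1`. When `n = 2` these exhaust `F`. When `n =
1` they are `x + x⁻¹ ± 1`, and a count shows that no hyperplane contains them all. -/

/-! ### Delsarte duality -/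

/-- The linear map `u ↦ ∑ uⱼ vⱼ` whose kernel is the ternary code of `v`. -/
noncomputable def syndromeMap {F : Type*} [Field F] [Algebra (ZMod 3) F] {N : ℕ} (v : Fin N → F) :
    (Fin N → ZMod 3) →ₗ[ZMod 3] F :=
  Fintype.linearCombination (ZMod 3) v

theorem mem_ternaryCode_iff {F : Type*} [Field F] [Algebra (ZMod 3) F] {N : ℕ} (v : Fin N → F)
    (u : Fin N → ZMod 3) : u ∈ ternaryCode v ↔ syndromeMap v u = 0 := by
  change (fun j => algebraMap (ZMod 3) F (u j)) ⬝ᵥ v = 0 ↔ _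
  simp [syndromeMap, Fintype.linearCombination_apply, dotProduct, Algebra.smul_def]

theorem traceWord_dotProduct {F : Type*} [Field F] [Algebra (ZMod 3) F] {N : ℕ} (v : Fin N → F)
    (a : F) (u : Fin N → ZMod 3) :
    traceWord v a ⬝ᵥ u = Algebra.trace (ZMod 3) F (a * syndromeMap v u) := by
  simp [syndromeMap, Fintype.linearCombination_apply, dotProduct, traceWord, Finset.mul_sum,
    mul_comm]

/-- Encoding `a ↦ c(a)` as a linear map. -/
noncomputable def traceWordLinear {F : Type*} [Field F] [Algebra (ZMod 3) F] {N : ℕ}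
    (v : Fin N → F) : F →ₗ[ZMod 3] (Fin N → ZMod 3) where
  toFun := traceWord v
  map_add' a b := by ext j; simp [traceWord, add_mul]
  map_smul' c a := by ext j; simp [traceWord]

/-- Delsarte's theorem for the code attached to `v`. -/
theorem range_traceWordLinear {F : Type*} [Field F] [Fintype F] [Algebra (ZMod 3) F] {N : ℕ}
    (v : Fin N → F) : LinearMap.range (traceWordLinear v) = dualCode (ternaryCode v) := by
  ext w
  constructor
  · rintro ⟨a, rfl⟩ u hu
    rw [mem_ternaryCode_iff] at hu
    change traceWord v a ⬝ᵥ u = 0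
    rw [traceWord_dotProduct, hu, mul_zero, map_zero]
  · intro hw
    -- As a functional, `w` kills the kernel of the syndrome map, hence factors through it as `ψ ∘
    -- syndromeMap v`; nondegeneracy gives `ψ = tr(a ·)`.
    have hann : Fintype.linearCombination (ZMod 3) w ∈
        (LinearMap.ker (syndromeMap v)).dualAnnihilator := by
      rw [Submodule.mem_dualAnnihilator]
      intro u hu
      have h := hw u ((mem_ternaryCode_iff v u).2 hu)
      rw [dotProduct_comm] at h
      simpa [Fintype.linearCombination_apply, dotProduct] using h
    rw [← LinearMap.range_dualMap_eq_dualAnnihilator_ker] at hann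
    obtain ⟨ψ, hψ⟩ := hann
    obtain ⟨a, ha⟩ := ((Algebra.traceForm (ZMod 3) F).toDual
      (traceForm_nondegenerate (ZMod 3) F)).surjective ψ
    refine ⟨a, ?_⟩
    ext j
    have h1 := LinearMap.congr_fun hψ (Pi.single j 1)
    rw [← ha] at h1
    simpa [syndromeMap, LinearMap.BilinForm.toDual_def, Algebra.traceForm_apply,
      traceWordLinear, traceWord] using h1

theorem eq_zero_of_forall_trace_mul_eq_zero {F : Type*} [Field F] [Fintype F]
    [Algebra (ZMod 3) F] {a : F} (h : ∀ t, Algebra.trace (ZMod 3) F (a * t) = 0) : a = 0 :=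
  (traceForm_nondegenerate (ZMod 3) F).1 a fun t => by
    simpa [Algebra.traceForm_apply] using h t

/-- No nonzero `a` is trace-orthogonal to all the traces of elements of `D`. -/
def TracesSeparate {F : Type*} [Field F] [Algebra (ZMod 3) F] {n : ℕ}
    (D : Set (Matrix (OIndex n) (OIndex n) F)) : Prop :=
  ∀ a : F, (∀ M ∈ D, Algebra.trace (ZMod 3) F (a * M.trace) = 0) → a = 0

theorem TracesSeparate.of_surjOn {F : Type*} [Field F] [Fintype F] [Algebra (ZMod 3) F] {n : ℕ}
    {D : Set (Matrix (OIndex n) (OIndex n) F)} (h : ∀ t : F, ∃ M ∈ D, M.trace = t) :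
    TracesSeparate D := by
  intro a ha
  refine eq_zero_of_forall_trace_mul_eq_zero fun t => ?_
  obtain ⟨M, hM, rfl⟩ := h t
  exact ha M hM

theorem TracesSeparate.exists_equiv {F : Type*} [Field F] [Fintype F] [Algebra (ZMod 3) F]
    {r n : ℕ} (hq : Fintype.card F = 3 ^ r) {D : Set (Matrix (OIndex n) (OIndex n) F)}
    (hD : TracesSeparate D) (g : Fin (Nat.card D) ≃ D) :
    (∃ e : F ≃ₗ[ZMod 3] dualCode (ternaryCode (traceVector g)),
      ∀ a : F, (e a : Fin (Nat.card D) → ZMod 3) = traceWord (traceVector g) a) ∧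
    Module.finrank (ZMod 3) (dualCode (ternaryCode (traceVector g))) = r := by
  have hinj : Function.Injective (traceWordLinear (traceVector g)) := by
    rw [injective_iff_map_eq_zero]
    intro a ha
    refine hD a fun M hM => ?_
    have h : traceWord (traceVector g) a (g.symm ⟨M, hM⟩) = 0 := congrFun ha _
    simp only [traceWord, traceVector] at h
    rwa [Equiv.apply_symm_apply] at h
  let e := (LinearEquiv.ofInjective _ hinj).trans
    (LinearEquiv.ofEq _ _ (range_traceWordLinear (traceVector g)))
  refine ⟨⟨e, fun a => rfl⟩, ?_⟩
  rw [← e.finrank_eq]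
  have h := Module.card_eq_pow_finrank (K := ZMod 3) (V := F)
  rw [hq, ZMod.card] at h
  exact (Nat.pow_right_injective (le_refl 2 |>.trans (by norm_num)) h).symm

/-! ### Elements of the double cosets and their traces -/

theorem one_mem_QSet (F : Type*) [Field F] (n : ℕ) : 1 ∈ QSet F n := by
  refine ⟨1, 0, 0, by simp, ?_⟩
  simp [leviMatrix, unipotentMatrix, Matrix.fromBlocks_one]

theorem three_eq_zero (F : Type*) [Field F] [Algebra (ZMod 3) F] : (3 : F) = 0 := by
  have : CharP F 3 := charP_of_injective_algebraMap (algebraMap (ZMod 3) F).injective 3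
  exact_mod_cast CharP.cast_eq_zero F 3

/-- Since `hᵀ * h` is symmetric, the condition on `B = hᵀ * h` reads `3 B = 0`. -/
theorem unipotentMatrix_mem_QSet {F : Type*} [Field F] [Algebra (ZMod 3) F] {n : ℕ}
    (h : Matrix (Fin 1) (Fin n) F) : unipotentMatrix (hᵀ * h) h ∈ QSet F n := by
  refine ⟨1, hᵀ * h, h, ?_, ?_⟩
  · ext i j
    simp only [Matrix.transpose_mul, Matrix.transpose_transpose, Matrix.add_apply,
      Matrix.zero_apply]
    linear_combination (hᵀ * h) i j * three_eq_zero F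
  · simp [leviMatrix, Matrix.fromBlocks_one]

theorem leviMatrix_mem_QSet {F : Type*} [Field F] {n : ℕ} (A : GL (Fin n) F) :
    leviMatrix A ∈ QSet F n :=
  ⟨A, 0, 0, by simp, by simp [unipotentMatrix, Matrix.fromBlocks_one]⟩

theorem trace_fromBlocks {R m l : Type*} [AddCommMonoid R] [Fintype m] [Fintype l]
    (A : Matrix m m R) (B : Matrix m l R) (C : Matrix l m R) (D : Matrix l l R) :
    (Matrix.fromBlocks A B C D).trace = A.trace + D.trace := by
  simp [Matrix.trace, Fintype.sum_sum_type]

theorem trace_leviMatrix {F : Type*} [Field F] {n : ℕ} (A : GL (Fin n) F) :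
    (leviMatrix A).trace = (A : Matrix (Fin n) (Fin n) F).trace +
      ((A⁻¹ : GL (Fin n) F) : Matrix (Fin n) (Fin n) F).trace + 1 := by
  simp [leviMatrix, trace_fromBlocks]

theorem trace_rhoMatrix_mul_leviMatrix {F : Type*} [Field F] {n : ℕ} (A : GL (Fin n) F) :
    (rhoMatrix F n * leviMatrix A).trace = (A : Matrix (Fin n) (Fin n) F).trace +
      ((A⁻¹ : GL (Fin n) F) : Matrix (Fin n) (Fin n) F).trace + -1 := by
  simp [leviMatrix, rhoMatrix, Matrix.fromBlocks_multiply, trace_fromBlocks]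

theorem sigmaMatrix_zero (F : Type*) [Field F] (n : ℕ) : sigmaMatrix F n 0 = 1 := by
  simp [sigmaMatrix, Matrix.fromBlocks_one]

theorem sigmaMatrix_mul_mem {F : Type*} [Field F] {n : ℕ} (k : ℕ)
    {w : Matrix (OIndex n) (OIndex n) F} (hw : w ∈ QSet F n) :
    sigmaMatrix F n k * w ∈ QSet F n * {sigmaMatrix F n k} * QSet F n := by
  have h := Set.mul_mem_mul (Set.mul_mem_mul (one_mem_QSet F n)
    (Set.mem_singleton (sigmaMatrix F n k))) hw
  rwa [one_mul] at h

theorem rhoMatrix_mul_sigmaMatrix_mul_mem {F : Type*} [Field F] {n : ℕ} (k : ℕ)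
    {w : Matrix (OIndex n) (OIndex n) F} (hw : w ∈ QSet F n) :
    rhoMatrix F n * sigmaMatrix F n k * w ∈
      {rhoMatrix F n} * QSet F n * {sigmaMatrix F n k} * QSet F n := by
  have h := Set.mul_mem_mul (Set.mul_mem_mul (Set.mul_mem_mul
    (Set.mem_singleton (rhoMatrix F n)) (one_mem_QSet F n))
    (Set.mem_singleton (sigmaMatrix F n k))) hw
  rwa [mul_one] at h

/-- The trace of the upper left `2n × 2n` block of `σ_k` times a unipotent matrix. -/
noncomputable def sigmaUnipotentTrace {F : Type*} [Field F] {n : ℕ} (k : ℕ)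
    (B : Matrix (Fin n) (Fin n) F) : F :=
  ∑ i : Fin n, if (i : ℕ) < k then B i i else 2

/-- A swapped index puts `B i i` on the diagonal; an unswapped one leaves two ones. -/
theorem trace_sigmaMatrix_mul_unipotentMatrix {F : Type*} [Field F] {n : ℕ} (k : ℕ)
    (B : Matrix (Fin n) (Fin n) F) (h : Matrix (Fin 1) (Fin n) F) :
    (sigmaMatrix F n k * unipotentMatrix B h).trace = sigmaUnipotentTrace k B + 1 := by
  simp [sigmaMatrix, unipotentMatrix, sigmaUnipotentTrace, Matrix.fromBlocks_multiply,
    trace_fromBlocks, Matrix.trace_add]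
  simp only [Matrix.trace, Matrix.diag, Matrix.diagonal_mul,
    ← Finset.sum_add_distrib]
  refine Finset.sum_congr rfl fun i _ => ?_
  split_ifs <;> norm_num

theorem trace_rhoMatrix_mul_sigmaMatrix_mul_unipotentMatrix {F : Type*} [Field F] {n : ℕ} (k : ℕ)
    (B : Matrix (Fin n) (Fin n) F) (h : Matrix (Fin 1) (Fin n) F) :
    (rhoMatrix F n * sigmaMatrix F n k * unipotentMatrix B h).trace =
      sigmaUnipotentTrace k B + -1 := by
  simp [rhoMatrix, sigmaMatrix, unipotentMatrix, sigmaUnipotentTrace, Matrix.fromBlocks_multiply,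
    trace_fromBlocks, Matrix.trace_add]
  simp only [Matrix.trace, Matrix.diag, Matrix.diagonal_mul,
    ← Finset.sum_add_distrib]
  refine Finset.sum_congr rfl fun i _ => ?_
  split_ifs <;> norm_num

/-! ### Sums of two squares: the case `k ≥ 2` -/

theorem exists_sq_add_sq {F : Type*} [Field F] [Fintype F] [Algebra (ZMod 3) F] (t : F) :
    ∃ x y : F, x ^ 2 + y ^ 2 = t := by
  have : CharP F 3 := charP_of_injective_algebraMap (algebraMap (ZMod 3) F).injective 3
  have hodd : Fintype.card F % 2 = 1 :=
    FiniteField.odd_card_of_char_ne_two (by rw [ringChar.eq F 3]; norm_num)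
  obtain ⟨x, y, h⟩ := FiniteField.exists_root_sum_quadratic (R := F)
    (Polynomial.degree_X_pow 2) (Polynomial.degree_X_pow_sub_C two_pos t) hodd
  refine ⟨x, y, ?_⟩
  simp only [Polynomial.eval_pow, Polynomial.eval_X, Polynomial.eval_sub,
    Polynomial.eval_C] at h
  linear_combination h

theorem exists_sigmaUnipotentTrace_eq {F : Type*} [Field F] [Fintype F] [Algebra (ZMod 3) F]
    {n k : ℕ} (hk : 2 ≤ k) (hn : k ≤ n) (t : F) :
    ∃ h : Matrix (Fin 1) (Fin n) F, sigmaUnipotentTrace k (hᵀ * h) = t := by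
  obtain ⟨m, rfl⟩ : ∃ m, n = m + 2 := ⟨n - 2, by omega⟩
  -- With `h = (x, y, 0, …)` the first two indices give `x² + y²`; the subtracted sum is the
  -- constant from the others.
  obtain ⟨x, y, hxy⟩ := exists_sq_add_sq
    (t - ∑ i : Fin m, if (i : ℕ) + 2 < k then 0 else 2)
  refine ⟨Matrix.of fun _ => Fin.cons x (Fin.cons y 0), ?_⟩
  have h1 : 1 < k := hk
  have h0 : 0 < k := by omega
  simp only [sigmaUnipotentTrace, Fin.sum_univ_succ, Matrix.mul_apply]
  simp [h0, h1, add_assoc]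
  linear_combination hxy

theorem TracesSeparate.doubleCoset {F : Type*} [Field F] [Fintype F] [Algebra (ZMod 3) F]
    {n k : ℕ} (hk : 2 ≤ k) (hn : k ≤ n) :
    TracesSeparate (QSet F n * {sigmaMatrix F n k} * QSet F n) := by
  refine .of_surjOn fun t => ?_
  obtain ⟨h, hh⟩ := exists_sigmaUnipotentTrace_eq hk hn (t - 1)
  refine ⟨_, sigmaMatrix_mul_mem k (unipotentMatrix_mem_QSet h), ?_⟩
  rw [trace_sigmaMatrix_mul_unipotentMatrix, hh, sub_add_cancel]

theorem TracesSeparate.rho_doubleCoset {F : Type*} [Field F] [Fintype F] [Algebra (ZMod 3) F]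
    {n k : ℕ} (hk : 2 ≤ k) (hn : k ≤ n) :
    TracesSeparate ({rhoMatrix F n} * QSet F n * {sigmaMatrix F n k} * QSet F n) := by
  refine .of_surjOn fun t => ?_
  obtain ⟨h, hh⟩ := exists_sigmaUnipotentTrace_eq hk hn (t + 1)
  refine ⟨_, rhoMatrix_mul_sigmaMatrix_mul_mem k (unipotentMatrix_mem_QSet h), ?_⟩
  rw [trace_rhoMatrix_mul_sigmaMatrix_mul_unipotentMatrix, hh, add_neg_cancel_right]

/-! ### Levi elements: the case `k = 0` -/

theorem leviMatrix_mem {F : Type*} [Field F] {n : ℕ} (A : GL (Fin n) F) :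
    leviMatrix A ∈ QSet F n * {sigmaMatrix F n 0} * QSet F n := by
  simpa [sigmaMatrix_zero] using sigmaMatrix_mul_mem 0 (leviMatrix_mem_QSet A)

theorem rhoMatrix_mul_leviMatrix_mem {F : Type*} [Field F] {n : ℕ} (A : GL (Fin n) F) :
    rhoMatrix F n * leviMatrix A ∈
      {rhoMatrix F n} * QSet F n * {sigmaMatrix F n 0} * QSet F n := by
  simpa [sigmaMatrix_zero] using rhoMatrix_mul_sigmaMatrix_mul_mem 0 (leviMatrix_mem_QSet A)

/-- In determinant 1 a 2 × 2 matrix and its inverse have equal trace; trace `-t` gives the sum `-2t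
= t`. -/
theorem exists_trace_add_trace_inv_eq {F : Type*} [Field F] [Algebra (ZMod 3) F] (t : F) :
    ∃ A : GL (Fin 2) F, (A : Matrix (Fin 2) (Fin 2) F).trace +
      ((A⁻¹ : GL (Fin 2) F) : Matrix (Fin 2) (Fin 2) F).trace = t := by
  refine ⟨⟨!![-t, -1; 1, 0], !![0, 1; -1, -t], ?_, ?_⟩, ?_⟩
  · simp [Matrix.one_fin_two]
  · simp [Matrix.one_fin_two]
  · simp only [Units.inv_mk, Matrix.trace_fin_two_of]
    linear_combination -t * three_eq_zero F

theorem TracesSeparate.doubleCoset_two {F : Type*} [Field F] [Fintype F] [Algebra (ZMod 3) F] :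
    TracesSeparate (QSet F 2 * {sigmaMatrix F 2 0} * QSet F 2) := by
  refine .of_surjOn fun t => ?_
  obtain ⟨A, hA⟩ := exists_trace_add_trace_inv_eq (t - 1)
  exact ⟨_, leviMatrix_mem A, by rw [trace_leviMatrix, hA, sub_add_cancel]⟩

theorem TracesSeparate.rho_doubleCoset_two {F : Type*} [Field F] [Fintype F]
    [Algebra (ZMod 3) F] :
    TracesSeparate ({rhoMatrix F 2} * QSet F 2 * {sigmaMatrix F 2 0} * QSet F 2) := by
  refine .of_surjOn fun t => ?_
  obtain ⟨A, hA⟩ := exists_trace_add_trace_inv_eq (t + 1)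
  exact ⟨_, rhoMatrix_mul_leviMatrix_mem A,
    by rw [trace_rhoMatrix_mul_leviMatrix, hA, add_neg_cancel_right]⟩

theorem three_mul_card_ker_le {F : Type*} [Field F] [Fintype F] [Algebra (ZMod 3) F]
    (ψ : F →ₗ[ZMod 3] ZMod 3) (hψ : ψ ≠ 0) :
    3 * Nat.card (LinearMap.ker ψ) ≤ Fintype.card F := by
  classical
  have hlt : Module.finrank (ZMod 3) (LinearMap.ker ψ) < Module.finrank (ZMod 3) F :=
    Submodule.finrank_lt (by rwa [Ne, LinearMap.ker_eq_top])
  rw [Nat.card_eq_fintype_card, Module.card_eq_pow_finrank (K := ZMod 3) (V := F),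
    Module.card_eq_pow_finrank (K := ZMod 3) (V := LinearMap.ker ψ), ZMod.card, ← pow_succ']
  exact Nat.pow_le_pow_right (by norm_num) hlt

/-- The values `x + x⁻¹ + c` are too numerous to lie in a hyperplane. -/
theorem eq_zero_of_forall_trace_mul_add_inv {F : Type*} [Field F] [Fintype F]
    [Algebra (ZMod 3) F] (c a : F)
    (h : ∀ x : Fˣ, Algebra.trace (ZMod 3) F (a * ((x : F) + (x⁻¹ : Fˣ) + c)) = 0) : a = 0 := by
  classical
  by_contra ha
  let ψ : F →ₗ[ZMod 3] ZMod 3 := Algebra.trace (ZMod 3) F ∘ₗ LinearMap.mulLeft (ZMod 3) a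
  have hψ : ψ ≠ 0 := fun h0 => ha <| eq_zero_of_forall_trace_mul_eq_zero fun t =>
    LinearMap.congr_fun h0 t
  have hker := three_mul_card_ker_le ψ hψ
  let f : Fˣ → LinearMap.ker ψ := fun x => ⟨(x : F) + (x⁻¹ : Fˣ) + c, h x⟩
  have hfib : ∀ b : LinearMap.ker ψ, (Finset.univ.filter fun x => f x = b).card ≤ 2 := by
    intro b
    by_contra! hb
    obtain ⟨x, y, z, hx, hy, hz, hxy, hxz, hyz⟩ := Finset.two_lt_card_iff.1 hb
    simp only [Finset.mem_filter, Finset.mem_univ, true_and] at hx hy hz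
    -- Equal values give `(x - y)(xy - 1) = 0`, so a fibre lies in `{x, x⁻¹}`.
    have key : ∀ x y : Fˣ, f x = f y → x ≠ y → (x : F) * y = 1 := by
      intro x y hf hne
      have h1 : (x : F) + (x : F)⁻¹ + c = (y : F) + (y : F)⁻¹ + c := by
        simpa [f] using hf
      have h2 : (x : F) - y ≠ 0 := sub_ne_zero.2 fun h => hne (Units.ext h)
      have h3 := x.ne_zero
      have h4 := y.ne_zero
      field_simp at h1
      refine mul_left_cancel₀ h2 ?_
      linear_combination h1
    have e1 := key x y (hx.trans hy.symm) hxy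
    have e2 := key x z (hx.trans hz.symm) hxz
    exact hyz (Units.ext (mul_left_cancel₀ x.ne_zero (e1.trans e2.symm)))
  have hcard : Fintype.card Fˣ ≤ 2 * Fintype.card (LinearMap.ker ψ) := by
    simpa using Finset.card_le_mul_card_image_of_maps_to
      (s := (Finset.univ : Finset Fˣ)) (t := Finset.univ) (f := f) (fun _ _ => Finset.mem_univ _)
      2 (fun b _ => hfib b)
  rw [Fintype.card_units] at hcard
  rw [Nat.card_eq_fintype_card] at hker
  -- With `K` the kernel size, `q - 1 ≤ 2K` and `3K ≤ q` leave only `K ≤ 1`. This is excluded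
  -- because `x = 1` and `x = -1` give values differing by `4 = 1`.
  have hone : Fintype.card (LinearMap.ker ψ) ≤ 1 := by omega
  have hsub := Fintype.card_le_one_iff.1 hone (f 1) (f (-1))
  have hval : (1 : F) + 1 + c = -1 + -1 + c := by simpa [f] using hsub
  exact one_ne_zero (α := F) (by linear_combination hval - three_eq_zero F)

/-- The scalar `x` as an element of `GL(1, F)`. -/
noncomputable def unitMatrix {F : Type*} [Field F] (x : Fˣ) : GL (Fin 1) F :=
  Units.map (Matrix.scalar (Fin 1) : F →+* _).toMonoidHom x

theorem trace_unitMatrix {F : Type*} [Field F] (x : Fˣ) :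
    (unitMatrix x : Matrix (Fin 1) (Fin 1) F).trace = x := by
  simp [unitMatrix]

theorem TracesSeparate.doubleCoset_one {F : Type*} [Field F] [Fintype F] [Algebra (ZMod 3) F] :
    TracesSeparate (QSet F 1 * {sigmaMatrix F 1 0} * QSet F 1) := by
  refine fun a ha => eq_zero_of_forall_trace_mul_add_inv 1 a fun x => ?_
  have h := ha _ (leviMatrix_mem (unitMatrix x))
  rwa [trace_leviMatrix, trace_unitMatrix, unitMatrix, ← map_inv, ← unitMatrix,
    trace_unitMatrix] at h

theorem TracesSeparate.rho_doubleCoset_one {F : Type*} [Field F] [Fintype F]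
    [Algebra (ZMod 3) F] :
    TracesSeparate ({rhoMatrix F 1} * QSet F 1 * {sigmaMatrix F 1 0} * QSet F 1) := by
  refine fun a ha => eq_zero_of_forall_trace_mul_add_inv (-1) a fun x => ?_
  have h := ha _ (rhoMatrix_mul_leviMatrix_mem (unitMatrix x))
  rwa [trace_rhoMatrix_mul_leviMatrix, trace_unitMatrix, unitMatrix, ← map_inv, ← unitMatrix,
    trace_unitMatrix] at h

theorem theorem4p2 (F : Type*) [Field F] [Fintype F] [Algebra (ZMod 3) F]
    (r : ℕ) (_hr : 0 < r) (_hq : Fintype.card F = 3 ^ r) :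
    (∀ n : ℕ, Odd n →
      ∀ D ∈ ({DCOneMinus F n, DCTwoMinus F n} : Set (Set (Matrix (OIndex n) (OIndex n) F))),
      ∀ g : Fin (Nat.card D) ≃ D,
        (∃ e : F ≃ₗ[ZMod 3] dualCode (ternaryCode (traceVector g)),
          ∀ a : F, (e a : Fin (Nat.card D) → ZMod 3) = traceWord (traceVector g) a) ∧
        Module.finrank (ZMod 3) (dualCode (ternaryCode (traceVector g))) = r) ∧
    (∀ n : ℕ, Even n → 2 ≤ n →
      ∀ D ∈ ({DCOnePlus F n, DCTwoPlus F n} : Set (Set (Matrix (OIndex n) (OIndex n) F))),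
      ∀ g : Fin (Nat.card D) ≃ D,
        (∃ e : F ≃ₗ[ZMod 3] dualCode (ternaryCode (traceVector g)),
          ∀ a : F, (e a : Fin (Nat.card D) → ZMod 3) = traceWord (traceVector g) a) ∧
        Module.finrank (ZMod 3) (dualCode (ternaryCode (traceVector g))) = r) := by
  refine ⟨fun n hn D hD g => TracesSeparate.exists_equiv _hq ?_ g,
    fun n hn h2 D hD g => TracesSeparate.exists_equiv _hq ?_ g⟩
  · obtain ⟨m, rfl⟩ := hn
    -- Here `k = n - 1 = 2m`, so `k ≥ 2` unless `n = 1`.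
    obtain rfl | hm := Nat.eq_zero_or_pos m
    · rcases hD with rfl | rfl
      · exact .doubleCoset_one
      · exact .rho_doubleCoset_one
    · rcases hD with rfl | rfl
      · exact .doubleCoset (by omega) (by omega)
      · exact .rho_doubleCoset (by omega) (by omega)
  · obtain ⟨m, rfl⟩ := hn
    -- Here `k = n - 2 = 2m - 2`, so `k ≥ 2` unless `n = 2`.
    obtain rfl | hm := (show 1 ≤ m by omega).eq_or_lt
    · rcases hD with rfl | rfl
      · exact .doubleCoset_two
      · exact .rho_doubleCoset_two
    · rcases hD with rfl | rfl
      · exact .doubleCoset (by omega) (by omega)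
      · exact .rho_doubleCoset (by omega) (by omega)
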